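/- Use six letters for the possible positions of the two edges of a 2-factor at a vertex of a grid: $a$ = {right, down}, $b$ = {up, down}, $c$ = {right, up}, $d$ = {left, down}, $e$ = {left, right}, $f$ = {left, up}. Let $m \ge 1$. The vertices of the circular transfer digraph $\mathcal D_{C,m}$ are the words $\alpha = \alpha_1\alpha_2\cdots\alpha_m$ over $\{a,b,c,d,e,f\}$ such that for every $1 \le i \le m$ (with $\alpha_{m+1} = \alpha_1$) the letter $\alpha_i$ contains "down" if and only if $\alpha_{i+1}$ contains "up". There is an arc $\alpha \to \beta$ if and only if for every $i$ the letter $\alpha_i$ contains "right" exactly when $\beta_i$ contains "left". (This digraph is common to the thin cylinder, torus and Klein bottle grid graphs of width $m$.) The outlet word $o(\alpha) \in \{0,1\}^m$ has $i$-th letter $1$ if $\alpha_i \in \{a,c,e\}$ and $0$ if $\alpha_i \in \{b,d,f\}$. The digraph $\mathcal D^*_{C,m}$ arises from $\mathcal D_{C,m}$ by gluing all vertices with the same outlet word into one vertex, named by this word, and replacing all arcs that start in the vertices glued to $v$ and end in the same vertex $\beta$ of $\mathcal D_{C,m}$ by a single arc from $v$ to $o(\beta)$. (So parallel arcs, for different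 $\beta$, are possible.) A component is a connected component of the underlying undirected graph, with the induced arcs. A digraph is bipartite if its vertices can be partitioned into two classes such that every arc joins vertices of different classes. **Theorem.** The vertices of $\mathcal D^*_{C,m}$ are all binary words of length $m$: every such word is the outlet word of a vertex of $\mathcal D_{C,m}$. 1. If $m \ge 2$ is even, then $\mathcal D^*_{C,m}$ has exactly $m/2 + 1$ components, $\mathcal A^*$ and $\mathcal B^{*(s)}$ for $1 \le s \le m/2$. The component $\mathcal A^*$ contains both $1^m$ and $0^m$ and has $\binom{m}{m/2}$ vertices. Each $\mathcal B^{*(s)}$ has $2\binom{m}{m/2-s}$ vertices and is bipartite. Every binary word $v$ of length $m$ lies in the same component as its reversal $\overline v$, and if this component is one of the $\mathcal B^{*(s)}$, then $v$ and $\overline v$ lie in different classes of its bipartition (of every bipartition of it). 2. If $m \ge 1$ is odd, then $\mathcal D^*_{C,m}$ has exactly two components, the one containing $1^m$ and the one containing $0^m$. Each has $2^{m-1}$ vertices, and they are isomorphic as digraphs (with multiplicities of arcs). An isomorphism is given on vertices by complementing every bit, and on arcs, each of which is given by a word $\beta \in V(\mathcal D_{C,m})$, by applying the letter exchange $a \leftrightarrow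 f$, $b \leftrightarrow e$, $c \leftrightarrow d$ to every letter of $\beta$. -/

import Mathlib

namespace GridTwoFactor

/-! ### Digraphs with parallel arcs: induced components, isomorphisms, bipartitions

A digraph in which parallel arcs and loops are allowed is a `Quiver`; its components are
the elements of `Quiver.WeaklyConnectedComponent`. -/

/-- The vertices of the component `C` of a digraph. -/
def ComponentVertex {V : Type*} [Quiver V] (C : Quiver.WeaklyConnectedComponent V) : Type _ :=
  {v : V // Quiver.WeaklyConnectedComponent.mk v = C}

/-- A component, viewed as a digraph on its own: the induced subdigraph. -/
instance instQuiverComponentVertex {V : Type*} [Quiver V]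
    (C : Quiver.WeaklyConnectedComponent V) : Quiver (ComponentVertex C) where
  Hom v w := v.1 ⟶ w.1

/-- An isomorphism of digraphs: a bijection of the vertices together with, for all vertices
`v` and `w`, a bijection of the arcs from `v` to `w` with the arcs between the images. -/
structure DigraphIso (V W : Type*) [Quiver V] [Quiver W] where
  onVertices : V ≃ W
  onArcs : ∀ v w : V, (v ⟶ w) ≃ (onVertices v ⟶ onVertices w)

/-- `R` and `G` are the two classes of a bipartition of the digraph: they partition the
vertices, and every arc joins vertices of different classes. -/
structure IsBipartition {V : Type*} [Quiver V] (R G : Set V) : Prop where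
  disjoint : Disjoint R G
  cover : R ∪ G = Set.univ
  arcs : ∀ v w : V, Nonempty (v ⟶ w) → (v ∈ R ∧ w ∈ G) ∨ (v ∈ G ∧ w ∈ R)

/-- A digraph is bipartite if it has a bipartition. -/
def IsBipartite (V : Type*) [Quiver V] : Prop :=
  ∃ R G : Set V, IsBipartition R G

/-! ### Code letters and the transfer digraph of circular grid graphs -/

/-- The six code letters: the possible positions of the two edges of a 2-factor at a vertex
of the grid. `a`: right and down, `b`: up and down, `c`: right and up, `d`: left and down,
`e`: left and right, `f`: left and up. -/
inductive Letter : Type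
  | a | b | c | d | e | f
  deriving DecidableEq

namespace Letter

/-- Does the edge to the right belong to the 2-factor? -/
def right : Letter → Bool
  | a | c | e => true
  | b | d | f => false

/-- Does the edge to the left belong to the 2-factor? -/
def left : Letter → Bool
  | d | e | f => true
  | a | b | c => false

/-- Does the upward edge belong to the 2-factor? -/
def up : Letter → Bool
  | b | c | f => true
  | a | d | e => false

/-- Does the downward edge belong to the 2-factor? -/
def down : Letter → Bool
  | a | b | d => true
  | c | e | f => false

/-- The exchange of letters `a ↔ f`, `b ↔ e`, `c ↔ d`. -/
def swap : Letter → Letter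
  | a => f
  | b => e
  | c => d
  | d => c
  | e => b
  | f => a

end Letter

/-- The auxiliary digraph on the letters: `x → y` if `y` can stand directly below `x`. -/
def upDownDigraph : Digraph Letter where
  Adj x y := x.down = y.up

/-- The auxiliary digraph on the letters: `x → y` if `y` can stand directly to the right
of `x`. -/
def leftRightDigraph : Digraph Letter where
  Adj x y := x.right = y.left

/-- The vertices of the circular transfer digraph of width `m`: the words of length `m` in
which any two circularly consecutive letters form an arc of `upDownDigraph`
(`finRotate m` is the cyclic successor of a position). -/
def AlphaWord (m : ℕ) : Type :=
  {α : Fin m → Letter // ∀ i : Fin m, upDownDigraph.Adj (α i) (α (finRotate m i))}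

/-- The circular transfer digraph of width `m`. -/
def transferDigraph (m : ℕ) : Digraph (AlphaWord m) where
  Adj α β := ∀ i : Fin m, leftRightDigraph.Adj (α.1 i) (β.1 i)

/-! ### The glued transfer digraph -/

/-- Binary words of length `m`: the vertices of the glued transfer digraph. -/
def BinWord (m : ℕ) : Type := Fin m → Bool

namespace BinWord

/-- The word `1^m`. -/
def ones (m : ℕ) : BinWord m := fun _ => true

/-- The word `0^m`. -/
def zeros (m : ℕ) : BinWord m := fun _ => false

/-- The reversal of a word. -/
def reverse {m : ℕ} (v : BinWord m) : BinWord m := fun i => v i.rev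

/-- The complementary word. -/
def complement {m : ℕ} (v : BinWord m) : BinWord m := fun i => !(v i)

end BinWord

/-- The outlet word of an alpha-word. -/
def outlet {m : ℕ} (α : AlphaWord m) : BinWord m := fun i => (α.1 i).right

/-- The glued circular transfer digraph of width `m`. All alpha-words with the same outlet word
are glued to one vertex, and all arcs that start in the alpha-words glued to `v` and end in the
same alpha-word `β` are replaced by one arc. So the arcs from `v` to `w` are the alpha-words `β`
with outlet word `w` to which the transfer digraph has an arc from some alpha-word with outlet
word `v`. -/
instance gluedTransferDigraph (m : ℕ) : Quiver (BinWord m) where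
  Hom v w := {β : AlphaWord m //
    outlet β = w ∧ ∃ α : AlphaWord m, outlet α = v ∧ (transferDigraph m).Adj α β}

/-- The components of the glued circular transfer digraph. -/
abbrev Component (m : ℕ) : Type := Quiver.WeaklyConnectedComponent (BinWord m)

/-- The component of the glued circular transfer digraph that contains the word `v`. -/
abbrev componentOf {m : ℕ} (v : BinWord m) : Component m :=
  Quiver.WeaklyConnectedComponent.mk v

end GridTwoFactor

open GridTwoFactor

namespace GridTwoFactor

/-! ### Components of a digraph -/

/-! Every vertex has degree 2, so there is an arc `v ⟶ w` exactly when some cyclic word `u` of "up"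
bits satisfies `v i + w i + u i + u (i + 1) = 2` for all `i` (`arc_of_balanced`, `balanced_of_arc`).
Everything about components is read off from this equation.

Connecting words: flipping two equal, circularly adjacent bits stays in the component, because the
old and the new word have a common out-neighbour (`componentOf_eq_of_flip`). After complementing the
bits at even positions (`twist`), such a flip at linearly adjacent positions swaps two unequal bits.
Adjacent transpositions generate the symmetric group, so the component depends only on the weight of
the twisted word (`componentOf_eq_of_weight_eq`).

Separating words, even `m`: the twist is compatible with the cycle, and summing the twisted equation
shows that the twisted weights at the ends of an arc add up to `m` (`weight_twist_add_of_arc`). The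
components are thus the pairs of twisted weights `m / 2 - s`, `m / 2 + s`, whose two members form
the bipartition for `s ≠ 0`. Reversal exchanges them.

Odd `m`: the first and last positions are both even, so a flip across the seam can raise the twisted
weight by 2, and only its parity can matter. Summing the untwisted equation shows that the parity of
the weight is invariant, which leaves two components, exchanged by complementation. -/

theorem mk_eq_of_arc {V : Type*} [Quiver V] {v w : V} (h : Nonempty (v ⟶ w)) :
    (Quiver.WeaklyConnectedComponent.mk v) = Quiver.WeaklyConnectedComponent.mk w := by
  obtain ⟨f⟩ := h
  rw [Quiver.WeaklyConnectedComponent.eq]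
  exact ⟨Quiver.Hom.toPath (Sum.inl f)⟩

/-- A function that is constant along arcs is constant on components. -/
theorem eq_of_mk_eq {V X : Type*} [Quiver V] (F : V → X)
    (hF : ∀ v w : V, Nonempty (v ⟶ w) → F v = F w) {v w : V}
    (h : (Quiver.WeaklyConnectedComponent.mk v) = Quiver.WeaklyConnectedComponent.mk w) :
    F v = F w := by
  rw [Quiver.WeaklyConnectedComponent.eq] at h
  obtain ⟨p⟩ := h
  induction p with
  | nil => rfl
  | cons p e ih =>
    rw [ih]
    rcases e with e | e
    · exact hF _ _ ⟨e⟩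
    · exact (hF _ _ ⟨e⟩).symm

/-! ### Arcs of the glued transfer digraph -/

/-- The letter with given values of `left`, `right` and `up`, if there is one. -/
def Letter.ofBits : Bool → Bool → Bool → Letter
  -- When `left` and `right` agree, degree 2 forces `up`, so it is ignored.
  | true, true, _ => .e
  | false, false, _ => .b
  | true, false, true => .f
  | true, false, false => .d
  | false, true, true => .c
  | false, true, false => .a

theorem Letter.ofBits_spec (l r u d : Bool)
    (h : l.toNat + r.toNat + u.toNat + d.toNat = 2) :
    (ofBits l r u).left = l ∧ (ofBits l r u).right = r ∧ (ofBits l r u).up = u ∧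
      (ofBits l r u).down = d := by
  revert l r u d; decide

theorem Letter.bits_sum (x : Letter) :
    x.left.toNat + x.right.toNat + x.up.toNat + x.down.toNat = 2 := by
  cases x <;> rfl

theorem exists_alphaWord {m : ℕ} (v w u : Fin m → Bool)
    (h : ∀ i, (v i).toNat + (w i).toNat + (u i).toNat + (u (finRotate m i)).toNat = 2) :
    ∃ β : AlphaWord m, ∀ i, (β.1 i).left = v i ∧ (β.1 i).right = w i ∧ (β.1 i).up = u i := by
  have H := fun i => Letter.ofBits_spec _ _ _ _ (h i)
  exact ⟨⟨fun i => .ofBits (v i) (w i) (u i), fun i => (H i).2.2.2.trans (H _).2.2.1.symm⟩,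
    fun i => ⟨(H i).1, (H i).2.1, (H i).2.2.1⟩⟩

theorem decide_even_succ (k : ℕ) : decide (Even (k + 1)) = !decide (Even k) := by
  rw [← decide_not, decide_eq_decide, Nat.even_add_one]

theorem decide_even_val_add_one {n : ℕ} (i : Fin (n + 1)) (h : i ≠ Fin.last n) :
    decide (Even (i + 1).val) = !decide (Even i.val) := by
  rw [Fin.val_add_one, if_neg h, decide_even_succ]

/-- Every binary word can be completed by vertical edges and one more column. -/
theorem exists_balanced {m : ℕ} (v : Fin m → Bool) : ∃ w u : Fin m → Bool,
    ∀ i, (v i).toNat + (w i).toNat + (u i).toNat + (u (finRotate m i)).toNat = 2 := by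
  rcases m with _ | n
  · exact ⟨v, v, fun i => i.elim0⟩
  -- With `u` alternating, complementing `v` balances every position but the last. There the choice
  -- `u 0 = !(v (Fin.last n))` leaves `w` to compensate `u (Fin.last n)`.
  let u : Fin (n + 1) → Bool := fun i => xor (decide (Even i.val)) (v (Fin.last n))
  refine ⟨fun i => if i = Fin.last n then !(u i) else !(v i), u, fun i => ?_⟩
  simp only [finRotate_apply]
  by_cases hi : i = Fin.last n
  · subst hi
    have : u (Fin.last n + 1) = !(v (Fin.last n)) := by simp [u]
    rw [this, if_pos rfl]
    cases v (Fin.last n) <;> cases u (Fin.last n) <;> rfl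
  · have : u (i + 1) = !(u i) := by
      simp only [u, decide_even_val_add_one i hi, Bool.not_xor]
    rw [this, if_neg hi]
    cases v i <;> cases u i <;> rfl

theorem exists_outlet_eq {m : ℕ} (v : BinWord m) : ∃ α : AlphaWord m, outlet α = v := by
  obtain ⟨w, u, h⟩ := exists_balanced v
  obtain ⟨β, hβ⟩ := exists_alphaWord w v u (fun i => by rw [← h i]; ring)
  exact ⟨β, funext fun i => (hβ i).2.1⟩

/-- Only the target column imposes a condition: some source column with outlet word `v` always
exists. -/
theorem arc_of_balanced {m : ℕ} (v w : BinWord m) (u : Fin m → Bool)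
    (h : ∀ i, (v i).toNat + (w i).toNat + (u i).toNat + (u (finRotate m i)).toNat = 2) :
    Nonempty (v ⟶ w) := by
  obtain ⟨β, hβ⟩ := exists_alphaWord v w u h
  obtain ⟨α, hα⟩ := exists_outlet_eq v
  exact ⟨⟨β, funext fun i => (hβ i).2.1, α, hα, fun i =>
    (congrFun hα i).trans (hβ i).1.symm⟩⟩

theorem left_of_arc {m : ℕ} {v w : BinWord m} (β : v ⟶ w) (i : Fin m) :
    (β.1.1 i).left = v i := by
  obtain ⟨β, -, α, hα, h⟩ := β
  exact ((h i).symm).trans (congrFun hα i)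

theorem balanced_of_arc {m : ℕ} {v w : BinWord m} (h : Nonempty (v ⟶ w)) :
    ∃ u : Fin m → Bool,
      ∀ i, (v i).toNat + (w i).toNat + (u i).toNat + (u (finRotate m i)).toNat = 2 := by
  obtain ⟨β⟩ := h
  refine ⟨fun i => (β.1.1 i).up, fun i => ?_⟩
  have h1 : (β.1.1 i).down = (β.1.1 (finRotate m i)).up := β.1.2 i
  have h2 : (β.1.1 i).right = w i := congrFun β.2.1 i
  dsimp only
  rw [← h1, ← left_of_arc β i, ← h2]
  exact Letter.bits_sum _

/-! ### The elementary move -/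

theorem componentOf_eq_of_flip_zeros {n : ℕ} (v v' : BinWord (n + 1)) (j : Fin (n + 1))
    (hjk : j + 1 ≠ j) (hj : v j = false) (hk : v (j + 1) = false)
    (hj' : v' j = true) (hk' : v' (j + 1) = true)
    (h : ∀ i, i ≠ j → i ≠ j + 1 → v' i = v i) : componentOf v = componentOf v' := by
  -- `u` starts with a one at `j + 1` and alternates around the cycle up to `j`, so the complement
  -- of `v` balances every position except possibly `j`, where `w j` is adjusted.
  let u : Fin (n + 1) → Bool := fun i => decide (Even (i - (j + 1)).val)
  let w : BinWord (n + 1) := fun i => if i = j then !(u j) else !(v i)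
  have hu : ∀ i, i ≠ j → u (i + 1) = !(u i) := by
    intro i hi
    have : i - (j + 1) ≠ Fin.last n := by
      intro h
      apply hi
      have h2 : i - (j + 1) + 1 = 0 := by rw [h, Fin.last_add_one]
      exact sub_eq_zero.mp (by rw [← h2]; abel)
    have h3 : i + 1 - (j + 1) = i - (j + 1) + 1 := by abel
    simp only [u, h3, decide_even_val_add_one _ this]
  have huk : u (j + 1) = true := by simp [u]
  have h1 : Nonempty (v ⟶ w) := by
    refine arc_of_balanced v w u fun i => ?_
    simp only [finRotate_apply]
    by_cases hi : i = j
    · subst hi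
      simp only [w, if_true, hj, huk]
      cases u i <;> rfl
    · simp only [w, if_neg hi, hu i hi]
      cases v i <;> cases u i <;> rfl
  have h2 : Nonempty (v' ⟶ w) := by
    -- Clearing the vertical edge between `j` and `j + 1` pays for the two new ones of `v'`, with
    -- the same `w`.
    refine arc_of_balanced v' w (Function.update u (j + 1) false) fun i => ?_
    simp only [finRotate_apply]
    by_cases hi : i = j
    · subst hi
      simp only [w, if_true, hj', Function.update_self, Function.update_of_ne hjk.symm]
      cases u i <;> rfl
    by_cases hi' : i = j + 1
    · have h3 : i + 1 ≠ i := by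
        intro h
        exact hjk (by rw [left_eq_add.mp h.symm, add_zero])
      subst hi'
      simp [w, if_neg hi, hk, hk', Function.update_of_ne h3, hu _ hi, huk]
    · rw [Function.update_of_ne hi', Function.update_of_ne (by simpa using hi), hu i hi,
        h i hi hi']
      simp only [w, if_neg hi]
      cases v i <;> cases u i <;> rfl
  exact (mk_eq_of_arc h1).trans (mk_eq_of_arc h2).symm

theorem componentOf_eq_of_flip {n : ℕ} (v v' : BinWord (n + 1)) (j : Fin (n + 1))
    (hjk : j + 1 ≠ j) (hv : v j = v (j + 1))
    (hj' : v' j = !(v j)) (hk' : v' (j + 1) = !(v (j + 1)))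
    (h : ∀ i, i ≠ j → i ≠ j + 1 → v' i = v i) : componentOf v = componentOf v' := by
  cases hj : v j
  · rw [← hv, hj] at hk'
    rw [hj] at hj' hv
    exact componentOf_eq_of_flip_zeros v v' j hjk hj hv.symm hj' hk' h
  · rw [← hv, hj] at hk'
    rw [hj] at hj' hv
    exact (componentOf_eq_of_flip_zeros v' v j hjk hj' hk' hj hv.symm
      fun i h1 h2 => (h i h1 h2).symm).symm

/-! ### Twisted words: complementing the bits at even positions -/

/-- Complement the bits at the even positions. -/
def twist {m : ℕ} (v : Fin m → Bool) : BinWord m := fun i => xor (v i) (decide (Even i.val))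

theorem twist_twist {m : ℕ} (v : Fin m → Bool) : twist (twist v) = v := by
  funext i; simp [twist]

/-- The number of ones of a word. -/
def weight {m : ℕ} (v : Fin m → Bool) : ℕ := ∑ i, (v i).toNat

theorem weight_eq_card {m : ℕ} (v : Fin m → Bool) :
    weight v = (Finset.univ.filter fun i => v i = true).card := by
  rw [Finset.card_filter]
  exact Finset.sum_congr rfl fun i _ => by cases v i <;> rfl

theorem weight_le {m : ℕ} (v : Fin m → Bool) : weight v ≤ m := by
  rw [weight_eq_card]
  exact (Finset.card_le_univ _).trans (by simp)

theorem weight_add_weight_not {m : ℕ} (v : Fin m → Bool) :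
    weight v + weight (fun i => !(v i)) = m := by
  have : ∀ i, (v i).toNat + (!(v i)).toNat = 1 := fun i => by cases v i <;> rfl
  simp [weight, ← Finset.sum_add_distrib, this]

theorem weight_comp_perm {m : ℕ} (v : Fin m → Bool) (σ : Equiv.Perm (Fin m)) :
    weight (v ∘ σ) = weight v := Equiv.sum_comp σ fun i => (v i).toNat

theorem card_weight_eq (m k : ℕ) : Nat.card {v : Fin m → Bool // weight v = k} = m.choose k := by
  have e : {v : Fin m → Bool // weight v = k} ≃ {s : Finset (Fin m) // s.card = k} :=
    { toFun := fun v => ⟨Finset.univ.filter fun i => v.1 i = true, by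
        rw [← weight_eq_card]; exact v.2⟩
      invFun := fun s => ⟨fun i => decide (i ∈ s.1), by
        rw [weight_eq_card]; simpa using s.2⟩
      left_inv := fun v => by ext i; simp
      right_inv := fun s => by ext i; simp }
  rw [Nat.card_congr e, Nat.card_eq_fintype_card, Fintype.card_finset_len, Fintype.card_fin]

theorem exists_weight_eq {m k : ℕ} (h : k ≤ m) : ∃ v : Fin m → Bool, weight v = k := by
  have : 0 < Nat.card {v : Fin m → Bool // weight v = k} := by
    rw [card_weight_eq]; exact Nat.choose_pos h
  obtain ⟨⟨v, hv⟩⟩ := (Nat.card_pos_iff.mp this).1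
  exact ⟨v, hv⟩

theorem exists_perm_of_weight_eq {m : ℕ} (v w : Fin m → Bool) (h : weight v = weight w) :
    ∃ σ : Equiv.Perm (Fin m), v = w ∘ σ := by
  have e : {i // v i = true} ≃ {i // w i = true} := Fintype.equivOfCardEq (by
    rw [Fintype.card_subtype, Fintype.card_subtype, ← weight_eq_card, ← weight_eq_card, h])
  refine ⟨e.extendSubtype, funext fun i => ?_⟩
  by_cases hi : v i = true
  · rw [hi]; exact (e.extendSubtype_mem i hi).symm
  · have := e.extendSubtype_not_mem i hi
    simp_all

/-- If the two bits differ, they become equal after twisting, and swapping them is the elementary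
flip. -/
theorem componentOf_twist_swap {n : ℕ} (y : Fin (n + 1) → Bool) (i : Fin n) :
    componentOf (twist (y ∘ Equiv.swap i.castSucc i.succ)) = componentOf (twist y) := by
  have hs : i.castSucc + 1 = i.succ := Fin.coeSucc_eq_succ
  have hne : i.succ ≠ i.castSucc := (Fin.castSucc_lt_succ).ne'
  by_cases h : y i.castSucc = y i.succ
  · congr 2
    funext k
    simp only [Function.comp_apply, Equiv.swap_apply_def]
    split_ifs with h1 h2 <;> simp_all
  · have h' : y i.succ = !(y i.castSucc) := by
      revert h; cases y i.castSucc <;> cases y i.succ <;> simp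
    symm
    apply componentOf_eq_of_flip _ _ i.castSucc (by rwa [hs])
    · rw [hs]
      simp only [twist, h', Fin.val_succ, Fin.val_castSucc, decide_even_succ, Bool.not_xor, Bool.xor_not,
        Bool.not_not]
    · simp [twist, h']
    · rw [hs]; simp [twist, h']
    · intro k h1 h2
      rw [hs] at h2
      simp [twist, Equiv.swap_apply_of_ne_of_ne h1 h2]

theorem componentOf_twist_comp_perm {n : ℕ} (σ : Equiv.Perm (Fin (n + 1)))
    (y : Fin (n + 1) → Bool) : componentOf (twist (y ∘ σ)) = componentOf (twist y) := by
  have hσ : σ ∈ Submonoid.closure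
      (Set.range fun i : Fin n => Equiv.swap i.castSucc i.succ) := by
    rw [Equiv.Perm.mclosure_swap_castSucc_succ]; trivial
  induction hσ using Submonoid.closure_induction generalizing y with
  | mem x hx =>
    obtain ⟨i, rfl⟩ := hx
    exact componentOf_twist_swap y i
  | one => rfl
  | mul σ τ _ _ h1 h2 => exact (h2 (y ∘ σ)).trans (h1 y)

theorem componentOf_twist_eq_of_weight_eq {m : ℕ} (y z : Fin m → Bool)
    (h : weight y = weight z) : componentOf (twist y) = componentOf (twist z) := by
  obtain ⟨σ, rfl⟩ := exists_perm_of_weight_eq y z h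
  rcases m with _ | n
  · rw [Subsingleton.elim σ 1]; rfl
  · exact componentOf_twist_comp_perm σ z

theorem componentOf_eq_of_weight_eq {m : ℕ} (v w : BinWord m)
    (h : weight (twist v) = weight (twist w)) : componentOf v = componentOf w := by
  exact (congrArg componentOf (twist_twist v)).symm.trans
    ((componentOf_twist_eq_of_weight_eq _ _ h).trans (congrArg componentOf (twist_twist w)))

/-! ### Even width -/

/-- The alternation closes up across the seam because `m` is even. -/
theorem decide_even_finRotate {m : ℕ} (hm : Even m) (i : Fin m) :
    decide (Even (finRotate m i).val) = !decide (Even i.val) := by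
  rcases m with _ | n
  · exact i.elim0
  simp only [finRotate_apply]
  by_cases hi : i = Fin.last n
  · subst hi
    rw [Fin.last_add_one, Fin.val_last, ← decide_even_succ]
    simp [hm]
  · exact decide_even_val_add_one i hi

theorem weight_twist_add_of_arc {m : ℕ} (hm : Even m) {v w : BinWord m}
    (h : Nonempty (v ⟶ w)) : weight (twist v) + weight (twist w) = m := by
  obtain ⟨u, hu⟩ := balanced_of_arc h
  -- Twisting turns the sum of `u i` and `u (i + 1)` into a difference, which cancels in the cyclic
  -- sum.
  have key : ∀ i, (twist v i).toNat + (twist w i).toNat + (twist u i).toNat =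
      1 + (twist u (finRotate m i)).toNat := by
    intro i
    have h1 := hu i
    simp only [twist, decide_even_finRotate hm]
    revert h1
    generalize decide (Even i.val) = e
    cases v i <;> cases w i <;> cases u i <;> cases u (finRotate m i) <;> cases e <;> simp
  have hsum := Finset.sum_congr (rfl : (Finset.univ : Finset (Fin m)) = Finset.univ)
    fun i _ => key i
  simp only [Finset.sum_add_distrib] at hsum
  rw [Equiv.sum_comp (finRotate m) fun i => (twist u i).toNat] at hsum
  simpa [weight] using hsum

theorem exists_arc {m : ℕ} (v : BinWord m) : ∃ w : BinWord m, Nonempty (v ⟶ w) := by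
  obtain ⟨w, u, h⟩ := exists_balanced v
  exact ⟨w, arc_of_balanced v w u h⟩

theorem componentOf_eq_iff_of_even {m : ℕ} (hm : Even m) (v w : BinWord m) :
    componentOf v = componentOf w ↔
      weight (twist w) = weight (twist v) ∨ weight (twist v) + weight (twist w) = m := by
  constructor
  · intro h
    -- An arc replaces the twisted weight `k` by `m - k`, so the smaller of the two is an invariant.
    have h1 := eq_of_mk_eq (fun x : BinWord m => min (weight (twist x)) (m - weight (twist x)))
      (fun x y hxy => by
        have := weight_twist_add_of_arc hm hxy
        omega) h
    have h2 := weight_le (twist v)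
    have h3 := weight_le (twist w)
    omega
  · rintro (h | h)
    · exact componentOf_eq_of_weight_eq v w h.symm
    · obtain ⟨x, hx⟩ := exists_arc v
      have := weight_twist_add_of_arc hm hx
      exact (mk_eq_of_arc hx).trans (componentOf_eq_of_weight_eq x w (by omega))

/-! ### Reversal and the twisted weight. -/

theorem decide_even_rev {m : ℕ} (hm : Even m) (i : Fin m) :
    decide (Even i.rev.val) = !decide (Even i.val) := by
  rw [← decide_not, decide_eq_decide, Fin.val_rev]
  have := i.isLt
  rw [Nat.even_sub (by omega)]
  simp [hm, Nat.even_add_one]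

theorem weight_twist_add_reverse {m : ℕ} (hm : Even m) (v : BinWord m) :
    weight (twist v) + weight (twist v.reverse) = m := by
  have : twist v.reverse = (fun i => !(twist v i)) ∘ (Fin.revPerm : Equiv.Perm (Fin m)) := by
    funext i
    simp only [twist, BinWord.reverse, Function.comp_apply, Fin.revPerm_apply,
      decide_even_rev hm, Bool.xor_not, Bool.not_not]
  rw [this, weight_comp_perm]
  exact weight_add_weight_not _

/-- Applied to the palindromes `1^m` and `0^m`, this places both in the component with `s = 0`. -/
theorem weight_twist_of_reverse_eq {m : ℕ} (hm : Even m) (v : BinWord m) (h : v.reverse = v) :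
    weight (twist v) = m / 2 := by
  have := weight_twist_add_reverse hm v
  rw [h] at this
  omega

/-- Twisting is an involution of the binary words. -/
def twistEquiv (m : ℕ) : BinWord m ≃ (Fin m → Bool) where
  toFun v := twist v
  invFun v := twist v
  left_inv v := twist_twist v
  right_inv v := twist_twist v

theorem card_weight_twist_eq (m k : ℕ) :
    Nat.card {v : BinWord m // weight (twist v) = k} = m.choose k := by
  rw [← card_weight_eq]
  exact Nat.card_congr ((twistEquiv m).subtypeEquiv fun v => Iff.rfl)

instance (m : ℕ) : Finite (BinWord m) := inferInstanceAs (Finite (Fin m → Bool))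

theorem card_weight_twist_eq_or (m k l : ℕ) (h : k ≠ l) :
    Nat.card {v : BinWord m // weight (twist v) = k ∨ weight (twist v) = l} =
      m.choose k + m.choose l := by
  have hd : Disjoint {v : BinWord m | weight (twist v) = k}
      {v : BinWord m | weight (twist v) = l} :=
    Set.disjoint_left.mpr fun v h1 h2 => h (h1.symm.trans h2)
  have := Set.ncard_union_eq hd
  rw [← card_weight_twist_eq, ← card_weight_twist_eq]
  exact this

/-- A word of prescribed twisted weight. -/
noncomputable def wordOfWeight {m k : ℕ} (h : k ≤ m) : BinWord m :=
  twist (exists_weight_eq h).choose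

theorem weight_wordOfWeight {m k : ℕ} (h : k ≤ m) : weight (twist (wordOfWeight h)) = k := by
  rw [wordOfWeight, twist_twist]
  exact (exists_weight_eq h).choose_spec

/-- The components for even width, numbered by the deviation of the twisted weight from
`m / 2`. -/
noncomputable def evenComponent (m : ℕ) (s : Fin (m / 2 + 1)) : Component m :=
  componentOf (wordOfWeight (show m / 2 - s.val ≤ m by omega))

theorem componentOf_eq_evenComponent_iff {m : ℕ} (hm : Even m) (v : BinWord m)
    (s : Fin (m / 2 + 1)) : componentOf v = evenComponent m s ↔
      weight (twist v) = m / 2 - s.val ∨ weight (twist v) = m / 2 + s.val := by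
  rw [evenComponent, componentOf_eq_iff_of_even hm, weight_wordOfWeight]
  obtain ⟨k, rfl⟩ := hm
  omega

theorem evenComponent_bijective {m : ℕ} (hm : Even m) :
    Function.Bijective (evenComponent m) := by
  constructor
  · intro s t h
    have := (componentOf_eq_evenComponent_iff hm _ t).mp h
    rw [weight_wordOfWeight] at this
    ext
    omega
  · intro C
    induction C using Quotient.inductionOn with
    | h v =>
      have hv := weight_le (twist v)
      obtain ⟨k, hk⟩ := hm
      -- The index is the distance of the twisted weight from `m / 2`.
      refine ⟨⟨max (m / 2) (weight (twist v)) - min (m / 2) (weight (twist v)), by omega⟩, ?_⟩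
      refine ((componentOf_eq_evenComponent_iff ⟨k, hk⟩ v _).mpr ?_).symm
      dsimp only
      omega

theorem card_evenComponent_zero {m : ℕ} (hm : Even m) :
    Nat.card (ComponentVertex (evenComponent m 0)) = m.choose (m / 2) := by
  rw [← card_weight_twist_eq]
  exact Nat.card_congr (Equiv.subtypeEquivRight fun v => by
    rw [componentOf_eq_evenComponent_iff hm]; simp)

theorem card_evenComponent_of_ne_zero {m : ℕ} (hm : Even m) {s : Fin (m / 2 + 1)} (hs : s ≠ 0) :
    Nat.card (ComponentVertex (evenComponent m s)) = 2 * m.choose (m / 2 - s.val) := by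
  have hs' : s.val ≠ 0 := fun h => hs (Fin.ext h)
  have h1 : m.choose (m / 2 + s.val) = m.choose (m / 2 - s.val) :=
    Nat.choose_symm_of_eq_add (by obtain ⟨k, rfl⟩ := hm; omega)
  rw [two_mul]
  nth_rw 2 [← h1]
  rw [← card_weight_twist_eq_or _ _ _ (by omega)]
  exact Nat.card_congr (Equiv.subtypeEquivRight fun v =>
    componentOf_eq_evenComponent_iff hm v s)

theorem isBipartite_evenComponent {m : ℕ} (hm : Even m) {s : Fin (m / 2 + 1)} (hs : s ≠ 0) :
    IsBipartite (ComponentVertex (evenComponent m s)) := by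
  have hs' : s.val ≠ 0 := fun h => hs (Fin.ext h)
  refine ⟨{v | weight (twist v.1) = m / 2 - s.val}, {v | weight (twist v.1) = m / 2 + s.val},
    Set.disjoint_left.mpr fun v h1 h2 => ?_, Set.eq_univ_of_forall fun v => ?_,
    fun v w h => ?_⟩
  · simp only [Set.mem_ofPred_eq] at h1 h2
    omega
  · exact (componentOf_eq_evenComponent_iff hm v.1 s).mp v.2
  · have hv := (componentOf_eq_evenComponent_iff hm v.1 s).mp v.2
    have hvw := weight_twist_add_of_arc hm (v := v.1) (w := w.1) h
    simp only [Set.mem_ofPred_eq]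
    obtain ⟨k, hk⟩ := hm
    omega

theorem IsBipartition.mem_right_iff {V : Type*} [Quiver V] {R G : Set V}
    (h : IsBipartition R G) (v : V) : v ∈ G ↔ v ∉ R :=
  ⟨fun h1 h2 => Set.disjoint_left.mp h.disjoint h2 h1,
    fun h1 => (h.cover.ge (Set.mem_univ v)).resolve_left h1⟩

/-- An arc changes both the class in the given bipartition and the choice between low and high
twisted weight. Hence the agreement of "in `R`" with "low weight" is constant on the component,
while reversal exchanges low and high. -/
theorem reverse_mem_iff_of_isBipartition {m : ℕ} (hm : Even m) {s : Fin (m / 2 + 1)}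
    (hs : s ≠ 0) {R G : Set (ComponentVertex (evenComponent m s))} (h : IsBipartition R G)
    (v w : ComponentVertex (evenComponent m s)) (hw : w.1 = BinWord.reverse v.1) :
    v ∈ R ↔ w ∈ G := by
  have hs' : s.val ≠ 0 := fun h => hs (Fin.ext h)
  have hwt := fun x : ComponentVertex (evenComponent m s) =>
    (componentOf_eq_evenComponent_iff hm x.1 s).mp x.2
  -- Quantifying over `hx` extends the predicate to all words, vacuously true off the component,
  -- since walks are taken in the whole digraph.
  have key := eq_of_mk_eq (fun x : BinWord m => ∀ hx : componentOf x = evenComponent m s,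
      ((⟨x, hx⟩ : ComponentVertex (evenComponent m s)) ∈ R ↔
        weight (twist x) = m / 2 - s.val))
    (fun x y hxy => by
      have hc : componentOf x = componentOf y := mk_eq_of_arc hxy
      have hN := weight_twist_add_of_arc hm hxy
      by_cases hx : componentOf x = evenComponent m s
      · have hy := hc.symm.trans hx
        have h1 := h.arcs ⟨x, hx⟩ ⟨y, hy⟩ hxy
        have hGx := h.mem_right_iff ⟨x, hx⟩
        have hGy := h.mem_right_iff ⟨y, hy⟩
        have h2 := hwt ⟨x, hx⟩
        have h3 : weight (twist x) = m / 2 - s.val ↔ ¬ weight (twist y) = m / 2 - s.val := by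
          obtain ⟨k, hk⟩ := hm
          dsimp only at h2
          omega
        simp only [hx, hy, forall_true_left, h3]
        apply propext
        tauto
      · have hy : ¬ componentOf y = evenComponent m s := fun h => hx (hc.trans h)
        simp only [hx, hy, IsEmpty.forall_iff])
    (v.2.trans w.2.symm)
  have key' : (v ∈ R ↔ weight (twist v.1) = m / 2 - s.val) ↔
      (w ∈ R ↔ weight (twist w.1) = m / 2 - s.val) :=
    ⟨fun hv => key.mp (fun _ => hv) w.2, fun hv => key.mpr (fun _ => hv) v.2⟩
  have h1 := weight_twist_add_reverse hm v.1
  rw [← hw] at h1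
  have h2 := hwt v
  have h3 : weight (twist v.1) = m / 2 - s.val ↔ ¬ weight (twist w.1) = m / 2 - s.val := by
    obtain ⟨k, hk⟩ := hm
    omega
  rw [h.mem_right_iff]
  tauto

/-! ### Odd width -/

theorem weight_mod_two_of_arc {m : ℕ} {v w : BinWord m} (h : Nonempty (v ⟶ w)) :
    weight v % 2 = weight w % 2 := by
  obtain ⟨u, hu⟩ := balanced_of_arc h
  have hsum := Finset.sum_congr (rfl : (Finset.univ : Finset (Fin m)) = Finset.univ)
    fun i _ => hu i
  simp only [Finset.sum_add_distrib] at hsum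
  rw [Equiv.sum_comp (finRotate m) fun i => (u i).toNat] at hsum
  simp only [Finset.sum_const, Finset.card_univ, Fintype.card_fin, smul_eq_mul] at hsum
  simp only [weight]
  omega

theorem weight_ones (m : ℕ) : weight (BinWord.ones m) = m := by simp [weight, BinWord.ones]

theorem weight_zeros (m : ℕ) : weight (BinWord.zeros m) = 0 := by simp [weight, BinWord.zeros]

theorem componentOf_ones_ne_zeros {m : ℕ} (hm : Odd m) :
    componentOf (BinWord.ones m) ≠ componentOf (BinWord.zeros m) := by
  intro h
  have := eq_of_mk_eq (fun x : BinWord m => weight x % 2)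
    (fun _ _ hxy => weight_mod_two_of_arc hxy) h
  simp only [weight_ones, weight_zeros] at this
  obtain ⟨k, hk⟩ := hm
  omega

/-- Two zeros of a twisted word of odd length can be moved to the two ends, which are
circularly adjacent, and then be changed into ones. -/
theorem exists_weight_twist_add_two {m : ℕ} (hm : Odd m) (v : BinWord m)
    (h : weight (twist v) + 2 ≤ m) : ∃ w : BinWord m,
      componentOf w = componentOf v ∧ weight (twist w) = weight (twist v) + 2 := by
  obtain ⟨n, rfl⟩ : ∃ n, m = n + 2 := ⟨m - 2, by omega⟩
  have hn : ¬ Even n := by simpa [Nat.odd_add] using hm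
  obtain ⟨t, ht⟩ := exists_weight_eq (show weight (twist v) ≤ n by omega)
  -- `y b` is the word `b t b`. Both ends sit at even positions because `n + 1` is even, so the
  -- twist keeps them equal and the flip across the seam applies.
  let y (b : Bool) : Fin (n + 2) → Bool := Fin.cons b (Fin.snoc t b : Fin (n + 1) → Bool)
  have hy0 : ∀ b, y b 0 = b := fun b => rfl
  have hy1 : ∀ b, y b (Fin.last (n + 1)) = b := fun b => by
    simp [y, ← Fin.succ_last]
  have hy : ∀ b, weight (y b) = weight t + 2 * b.toNat := fun b => by
    simp only [weight, y, Fin.sum_univ_succ (n := n + 1), Fin.cons_zero, Fin.cons_succ,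
      Fin.sum_univ_castSucc (n := n), Fin.snoc_castSucc, Fin.snoc_last]
    ring
  have hlast : Fin.last (n + 1) + 1 = 0 := Fin.last_add_one _
  refine ⟨twist (y true), ?_, ?_⟩
  · have h1 : componentOf v = componentOf (twist (y false)) :=
      componentOf_eq_of_weight_eq _ _ (by rw [twist_twist, hy, ht]; rfl)
    rw [h1]
    apply componentOf_eq_of_flip _ _ (Fin.last (n + 1))
    · rw [hlast]; simp [Fin.ext_iff]
    · rw [hlast]; simp [twist, hy0, hy1, Nat.even_add_one, hn]
    · simp [twist, hy1]
    · rw [hlast]; simp [twist, hy0]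
    · intro i h1 h2
      rw [hlast] at h2
      obtain ⟨i, rfl⟩ := Fin.exists_succ_eq.mpr h2
      obtain ⟨i, rfl⟩ := Fin.exists_castSucc_eq.mpr
        (show i ≠ Fin.last n from fun h => h1 (by rw [h, Fin.succ_last]))
      simp [twist, y]
  · rw [twist_twist, hy, ht]; rfl

theorem componentOf_eq_of_weight_mod_two {m : ℕ} (hm : Odd m) (v w : BinWord m)
    (h : weight (twist v) % 2 = weight (twist w) % 2) : componentOf v = componentOf w := by
  wlog hle : weight (twist v) ≤ weight (twist w) generalizing v w
  · exact (this w v h.symm (by omega)).symm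
  obtain ⟨k, hk⟩ : ∃ k, weight (twist w) = weight (twist v) + 2 * k :=
    ⟨(weight (twist w) - weight (twist v)) / 2, by omega⟩
  clear h hle
  induction k generalizing v with
  | zero => exact componentOf_eq_of_weight_eq v w hk.symm
  | succ k ih =>
    have := weight_le (twist w)
    obtain ⟨x, hx, hx'⟩ := exists_weight_twist_add_two hm v (by omega)
    exact hx.symm.trans (ih x (by omega))

theorem twist_complement {m : ℕ} (v : BinWord m) :
    twist v.complement = fun i => !(twist v i) := by
  funext i; simp [twist, BinWord.complement]

theorem componentOf_eq_ones_or_zeros {m : ℕ} (hm : Odd m) (v : BinWord m) :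
    componentOf v = componentOf (BinWord.ones m) ∨
      componentOf v = componentOf (BinWord.zeros m) := by
  -- The twisted weights of `0^m` and `1^m` add up to the odd number `m`, so they represent both
  -- parities.
  have h := weight_add_weight_not (twist (BinWord.zeros m))
  rw [← twist_complement, show (BinWord.zeros m).complement = BinWord.ones m from rfl] at h
  have h1 : weight (twist v) % 2 = weight (twist (BinWord.ones m)) % 2 ∨
      weight (twist v) % 2 = weight (twist (BinWord.zeros m)) % 2 := by
    obtain ⟨k, hk⟩ := hm
    omega
  exact h1.imp (componentOf_eq_of_weight_mod_two hm _ _) (componentOf_eq_of_weight_mod_two hm _ _)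

/-! ### Complementation as an isomorphism of the two components for odd width. -/

theorem complement_complement {m : ℕ} (v : BinWord m) : v.complement.complement = v := by
  funext i; simp [BinWord.complement]

theorem Letter.swap_swap (x : Letter) : x.swap.swap = x := by cases x <;> rfl

theorem Letter.right_swap (x : Letter) : x.swap.right = !x.right := by cases x <;> rfl

theorem Letter.left_swap (x : Letter) : x.swap.left = !x.left := by cases x <;> rfl

theorem Letter.up_swap (x : Letter) : x.swap.up = !x.up := by cases x <;> rfl

theorem Letter.down_swap (x : Letter) : x.swap.down = !x.down := by cases x <;> rfl

/-- Apply the letter exchange to every letter of an alpha-word. -/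
def AlphaWord.swap {m : ℕ} (α : AlphaWord m) : AlphaWord m :=
  ⟨fun i => (α.1 i).swap, fun i => by
    have : (α.1 i).down = (α.1 (finRotate m i)).up := α.2 i
    simp [upDownDigraph, Letter.up_swap, Letter.down_swap, this]⟩

theorem AlphaWord.swap_swap {m : ℕ} (α : AlphaWord m) : α.swap.swap = α :=
  Subtype.ext (funext fun i => Letter.swap_swap (α.1 i))

theorem outlet_swap {m : ℕ} (α : AlphaWord m) : outlet α.swap = (outlet α).complement :=
  funext fun i => Letter.right_swap (α.1 i)

theorem adj_swap {m : ℕ} {α β : AlphaWord m} (h : (transferDigraph m).Adj α β) :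
    (transferDigraph m).Adj α.swap β.swap := fun i => by
  have : (α.1 i).right = (β.1 i).left := h i
  simp [leftRightDigraph, AlphaWord.swap, Letter.right_swap, Letter.left_swap, this]

/-- The image of an arc under complementation. -/
def swapArc {m : ℕ} {v w : BinWord m} (β : v ⟶ w) : v.complement ⟶ w.complement :=
  ⟨β.1.swap, by rw [outlet_swap, β.2.1], by
    obtain ⟨α, hα, h⟩ := β.2.2
    exact ⟨α.swap, by rw [outlet_swap, hα], adj_swap h⟩⟩

/-- Complementation is a bijection on arcs. -/
def swapArcEquiv {m : ℕ} (v w : BinWord m) : (v ⟶ w) ≃ (v.complement ⟶ w.complement) where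
  toFun := swapArc
  -- The inverse is built directly, as `v.complement.complement` is only propositionally equal to
  -- `v`.
  invFun β := ⟨β.1.swap, by rw [outlet_swap, β.2.1, complement_complement], by
    obtain ⟨α, hα, h⟩ := β.2.2
    exact ⟨α.swap, by rw [outlet_swap, hα, complement_complement], adj_swap h⟩⟩
  left_inv β := Subtype.ext (AlphaWord.swap_swap β.1)
  right_inv β := Subtype.ext (AlphaWord.swap_swap β.1)

theorem componentOf_complement {m : ℕ} {v w : BinWord m} (h : componentOf v = componentOf w) :
    componentOf v.complement = componentOf w.complement :=
  eq_of_mk_eq (fun x : BinWord m => componentOf x.complement)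
    (fun _ _ ⟨β⟩ => mk_eq_of_arc ⟨swapArc β⟩) h

/-- Complementation is an isomorphism of the two components for odd width. -/
def complementIso (m : ℕ) : DigraphIso (ComponentVertex (componentOf (BinWord.ones m)))
    (ComponentVertex (componentOf (BinWord.zeros m))) where
  onVertices :=
    { toFun := fun v => ⟨v.1.complement, componentOf_complement v.2⟩
      invFun := fun v => ⟨v.1.complement, componentOf_complement v.2⟩
      left_inv := fun v => Subtype.ext (complement_complement v.1)
      right_inv := fun v => Subtype.ext (complement_complement v.1) }
  onArcs v w := swapArcEquiv v.1 w.1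

theorem card_componentOf_ones {m : ℕ} (hm : Odd m) :
    Nat.card (ComponentVertex (componentOf (BinWord.ones m))) = 2 ^ (m - 1) := by
  have h1 := Nat.card_congr (complementIso m).onVertices
  have h2 : Nat.card (BinWord m) = 2 ^ m := by
    rw [show BinWord m = (Fin m → Bool) from rfl]
    simp
  have hd : Disjoint {v : BinWord m | componentOf v = componentOf (BinWord.ones m)}
      {v : BinWord m | componentOf v = componentOf (BinWord.zeros m)} :=
    Set.disjoint_left.mpr fun v h1 h2 => componentOf_ones_ne_zeros hm (h1.symm.trans h2)
  have h3 := Set.ncard_union_eq hd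
  rw [show {v : BinWord m | componentOf v = componentOf (BinWord.ones m)} ∪
      {v : BinWord m | componentOf v = componentOf (BinWord.zeros m)} = Set.univ from
    Set.eq_univ_of_forall (componentOf_eq_ones_or_zeros hm), Set.ncard_univ, h2] at h3
  change 2 ^ m = Nat.card (ComponentVertex (componentOf (BinWord.ones m))) +
    Nat.card (ComponentVertex (componentOf (BinWord.zeros m))) at h3
  obtain ⟨k, rfl⟩ := hm
  rw [pow_succ] at h3
  rw [Nat.add_sub_cancel]
  omega

end GridTwoFactor

theorem theorem4 (m : ℕ) (hm : 1 ≤ m) :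
    -- every binary word of length `m` is an outlet word, i.e. arises in the gluing
    (∀ v : BinWord m, ∃ α : AlphaWord m, outlet α = v) ∧
    -- `m` even: `K 0` is the component `A`, and `K s` is the component `B^(s)`
    (Even m →
      (∃ K : Fin (m / 2 + 1) ≃ Component m,
        componentOf (BinWord.ones m) = K 0 ∧
        componentOf (BinWord.zeros m) = K 0 ∧
        Nat.card (ComponentVertex (K 0)) = m.choose (m / 2) ∧
        ∀ s : Fin (m / 2 + 1), s ≠ 0 →
          Nat.card (ComponentVertex (K s)) = 2 * m.choose (m / 2 - (s : ℕ)) ∧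
          IsBipartite (ComponentVertex (K s)) ∧
          ∀ R G : Set (ComponentVertex (K s)), IsBipartition R G →
            ∀ v w : ComponentVertex (K s), w.1 = BinWord.reverse v.1 → (v ∈ R ↔ w ∈ G)) ∧
      ∀ v : BinWord m, componentOf (BinWord.reverse v) = componentOf v) ∧
    -- `m` odd
    (Odd m →
      componentOf (BinWord.ones m) ≠ componentOf (BinWord.zeros m) ∧
      (∀ C : Component m,
        C = componentOf (BinWord.ones m) ∨ C = componentOf (BinWord.zeros m)) ∧
      Nat.card (ComponentVertex (componentOf (BinWord.ones m))) = 2 ^ (m - 1) ∧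
      Nat.card (ComponentVertex (componentOf (BinWord.zeros m))) = 2 ^ (m - 1) ∧
      ∃ φ : DigraphIso (ComponentVertex (componentOf (BinWord.ones m)))
          (ComponentVertex (componentOf (BinWord.zeros m))),
        (∀ v, (φ.onVertices v).1 = BinWord.complement v.1) ∧
        ∀ v w (β : v ⟶ w) (i : Fin m), (φ.onArcs v w β).1.1 i = (β.1.1 i).swap) := by
  refine ⟨exists_outlet_eq, fun he => ⟨⟨Equiv.ofBijective _ (evenComponent_bijective he),
    ?_, ?_, card_evenComponent_zero he, fun s hs => ⟨card_evenComponent_of_ne_zero he hs,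
      isBipartite_evenComponent he hs, fun R G h => reverse_mem_iff_of_isBipartition he hs h⟩⟩,
    fun v => ?_⟩, fun ho => ⟨componentOf_ones_ne_zeros ho, fun C => ?_,
      card_componentOf_ones ho, ?_, complementIso m, fun _ => rfl, fun _ _ _ _ => rfl⟩⟩
  · exact (componentOf_eq_evenComponent_iff he _ 0).mpr
      (Or.inl (weight_twist_of_reverse_eq he (BinWord.ones m) rfl))
  · exact (componentOf_eq_evenComponent_iff he _ 0).mpr
      (Or.inl (weight_twist_of_reverse_eq he (BinWord.zeros m) rfl))
  · refine (componentOf_eq_iff_of_even he _ _).mpr (Or.inr ?_)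
    rw [add_comm]
    exact weight_twist_add_reverse he v
  · induction C using Quotient.inductionOn with
    | h v => exact componentOf_eq_ones_or_zeros ho v
  · rw [← Nat.card_congr (complementIso m).onVertices]
    exact card_componentOf_ones ho
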